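/- Let $X,Y$ be Banach spaces, $1\le p,q<\infty$, and let $f:\mathbb R\times X\to Y$ be any map (no regularity is assumed). Functions that are equal almost everywhere are identified. $L^p_{loc}(\mathbb R,X)$ is the space of functions $u:\mathbb R\to X$ whose restriction to every bounded interval is $p$-integrable in the sense of Bochner. For such $u$ let $u^b:\mathbb R\to L^p(0,1;X)$, $u^b(t)(\theta)=u(t+\theta)$, be its Bochner transform. Let $BS^p(\mathbb R,X)$ be the space of those $u\in L^p_{loc}(\mathbb R,X)$ for which $$\|u\|_{S^p}=\sup_{t\in\mathbb R}\Big(\int_0^1\|u(t+\theta)\|^p\,d\theta\Big)^{1/p}=\sup_{t\in\mathbb R}\|u^b(t)\|_{L^p(0,1;X)}<\infty .$$ Let $S^p_{ap}(\mathbb R,X)$ be the space of those $u\in L^p_{loc}(\mathbb R,X)$ for which $u^b$ is almost periodic in the sense of Bohr, i.e. $u^b$ is continuous and for every $\varepsilon>0$ there is $\ell>0$ such that every interval $[\alpha,\alpha+\ell]$, $\alpha\in\mathbb R$, contains some $\tau$ with $\sup_{t\in\mathbb R}\|u^b(t+\tau)-u^b(t)\|_{L^p(0,1;X)}\le\varepsilon$.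 Let $L^p_1(\mathbb R,X)$ be the space of those $u\in L^p_{loc}(\mathbb R,X)$ with $u(t+1)=u(t)$ for a.e. $t\in\mathbb R$. Both $S^p_{ap}(\mathbb R,X)$ and $L^p_1(\mathbb R,X)$ are contained in $BS^p(\mathbb R,X)$ and carry the norm $\|\cdot\|_{S^p}$; the same notation is used with $(q,Y)$ in place of $(p,X)$. For $u:\mathbb R\to X$ put $\mathcal N_f(u)(t)=f(t,u(t))$, $t\in\mathbb R$. The following three assertions are equivalent. (i) $\mathcal N_f$ maps $S^p_{ap}(\mathbb R,X)$ into $S^q_{ap}(\mathbb R,Y)$ and $\mathcal N_f:S^p_{ap}(\mathbb R,X)\to S^q_{ap}(\mathbb R,Y)$ is continuous. (ii) The operator $G:L^p_1(\mathbb R,X)\to S^q_{ap}(\mathbb R,Y)$, $G(u)=\mathcal N_f(u)$, is well-defined and continuous. (iii) For all $x\in X$ one has $f(\cdot,x)\in S^q_{ap}(\mathbb R,Y)$, and the operator $H:L^p_1(\mathbb R,X)\to BS^q(\mathbb R,Y)$, $H(u)=\mathcal N_f(u)$, is well-defined and continuous. -/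

import Mathlib

open MeasureTheory Set

noncomputable section

namespace Stepanov

section Functions

variable {E : Type*} [NormedAddCommGroup E]

/-- A set of reals is relatively dense if some fixed length `l > 0` works: every closed interval of
length `l` meets the set. -/
def RelativelyDense (D : Set ℝ) : Prop :=
  ∃ l : ℝ, 0 < l ∧ ∀ a : ℝ, (D ∩ Icc a (a + l)).Nonempty

/-- The set of `ε`-almost periods of `g`. -/
def almostPeriods (g : ℝ → E) (ε : ℝ) : Set ℝ :=
  {τ | ∀ t : ℝ, ‖g (t + τ) - g t‖ ≤ ε}

/-- Almost periodic functions in the sense of Bohr. -/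
def IsAlmostPeriodic (g : ℝ → E) : Prop :=
  Continuous g ∧ ∀ ε : ℝ, 0 < ε → RelativelyDense (almostPeriods g ε)

theorem IsAlmostPeriodic.bounded {g : ℝ → E} (hg : IsAlmostPeriodic g) :
    BddAbove (range fun t => ‖g t‖) := by
  obtain ⟨l, hl, hD⟩ := hg.2 1 one_pos
  obtain ⟨C, hC⟩ := (isCompact_Icc (a := (0 : ℝ)) (b := l)).exists_bound_of_continuousOn
    hg.1.continuousOn
  refine ⟨C + 1, ?_⟩
  rintro _ ⟨t, rfl⟩
  obtain ⟨τ, hτ, h1, h2⟩ := hD (-t)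
  have h3 := hC (t + τ) ⟨by linarith, by linarith⟩
  have h4 := hτ t
  have h5 : ‖g t‖ ≤ ‖g (t + τ)‖ + ‖g (t + τ) - g t‖ := by
    simpa using norm_sub_le (g (t + τ)) (g (t + τ) - g t)
  simp only
  linarith

end Functions

section Spaces

variable {X : Type*} [NormedAddCommGroup X]

/-- `u ∈ L^p_loc(ℝ, X)`: the restriction of `u` to every bounded interval is in `L^p`. -/
def MemLpLoc (p : ENNReal) (u : ℝ → X) : Prop :=
  ∀ a b : ℝ, MemLp u p (volume.restrict (Ioo a b))

/-- The Banach space `L^p(0, 1; X)`. -/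
abbrev LpUnit (p : ENNReal) (X : Type*) [NormedAddCommGroup X] :=
  Lp X p (volume.restrict (Ioo (0 : ℝ) 1))

theorem measurePreserving_shift (t : ℝ) :
    MeasurePreserving (fun θ : ℝ => t + θ) (volume.restrict (Ioo (0 : ℝ) 1))
      (volume.restrict (Ioo t (t + 1))) := by
  have h := (measurePreserving_add_left (volume : Measure ℝ) t).restrict_preimage
    (measurableSet_Ioo (a := t) (b := t + 1))
  simpa using h

theorem MemLpLoc.shift {p : ENNReal} {u : ℝ → X} (hu : MemLpLoc p u) (t : ℝ) :
    MemLp (fun θ => u (t + θ)) p (volume.restrict (Ioo (0 : ℝ) 1)) :=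
  (hu t (t + 1)).comp_measurePreserving (measurePreserving_shift t)

/-- The Bochner transform `u^b : ℝ → L^p(0, 1; X)`, `u^b(t)(θ) = u(t + θ)`. -/
def bochnerTransform {p : ENNReal} (u : ℝ → X) (hu : MemLpLoc p u) (t : ℝ) : LpUnit p X :=
  (hu.shift t).toLp (fun θ => u (t + θ))

/-- `u ∈ BS^p(ℝ, X)`: the function `u` is in `L^p_loc` and its Bochner transform is bounded. -/
def MemBS (p : ENNReal) (u : ℝ → X) : Prop :=
  ∃ hu : MemLpLoc p u, BddAbove (range fun t => ‖bochnerTransform u hu t‖)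

/-- `u ∈ S^p_ap(ℝ, X)`: the function `u` is in `L^p_loc` and its Bochner transform is (Bohr) almost
periodic with values in `L^p(0, 1; X)`. -/
def MemSap (p : ENNReal) [Fact (1 ≤ p)] (u : ℝ → X) : Prop :=
  ∃ hu : MemLpLoc p u, IsAlmostPeriodic (bochnerTransform u hu)

/-- `u ∈ L^p_1(ℝ, X)`: the function `u` is in `L^p_loc` and it is 1-periodic almost everywhere. -/
def MemPeriodic (p : ENNReal) (u : ℝ → X) : Prop :=
  MemLpLoc p u ∧ ∀ᵐ t : ℝ, u (t + 1) = u t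

theorem MemLpLoc.congr {p : ENNReal} {u v : ℝ → X} (hu : MemLpLoc p u) (h : u =ᵐ[volume] v) :
    MemLpLoc p v :=
  fun a b => (hu a b).ae_eq (ae_restrict_of_ae h)

theorem shift_ae_eq {Z : Type*} {u v : ℝ → Z} (h : u =ᵐ[volume] v) (t : ℝ) :
    (fun θ => u (t + θ)) =ᵐ[volume.restrict (Ioo (0 : ℝ) 1)] fun θ => v (t + θ) :=
  ae_restrict_of_ae ((measurePreserving_add_left volume t).quasiMeasurePreserving.ae_eq_comp h)

theorem bochnerTransform_congr {p : ENNReal} {u v : ℝ → X} (hu : MemLpLoc p u)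
    (hv : MemLpLoc p v) (h : u =ᵐ[volume] v) :
    bochnerTransform u hu = bochnerTransform v hv :=
  funext fun t => (MemLp.toLp_eq_toLp_iff _ _).2 (shift_ae_eq h t)

theorem MemBS.congr {p : ENNReal} {u v : ℝ → X} (hu : MemBS p u) (h : u =ᵐ[volume] v) :
    MemBS p v := by
  obtain ⟨hl, hb⟩ := hu
  exact ⟨hl.congr h, by rwa [← bochnerTransform_congr hl (hl.congr h) h]⟩

theorem MemLpLoc.add {p : ENNReal} {u v : ℝ → X} (hu : MemLpLoc p u) (hv : MemLpLoc p v) :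
    MemLpLoc p (u + v) :=
  fun a b => (hu a b).add (hv a b)

theorem MemLpLoc.neg {p : ENNReal} {u : ℝ → X} (hu : MemLpLoc p u) : MemLpLoc p (-u) :=
  fun a b => (hu a b).neg

theorem MemLpLoc.zero (p : ENNReal) : MemLpLoc p (0 : ℝ → X) :=
  fun _ _ => MemLp.zero

theorem bochnerTransform_add {p : ENNReal} {u v : ℝ → X} (hu : MemLpLoc p u)
    (hv : MemLpLoc p v) (t : ℝ) :
    bochnerTransform (u + v) (hu.add hv) t = bochnerTransform u hu t + bochnerTransform v hv t :=
  rfl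

theorem bochnerTransform_neg {p : ENNReal} {u : ℝ → X} (hu : MemLpLoc p u) (t : ℝ) :
    bochnerTransform (-u) hu.neg t = -bochnerTransform u hu t :=
  rfl

theorem bochnerTransform_zero {p : ENNReal} (t : ℝ) :
    bochnerTransform (0 : ℝ → X) (MemLpLoc.zero p) t = 0 :=
  rfl

/-- A Stepanov almost periodic function is bounded in the sense of Stepanov. -/
theorem MemSap.memBS {p : ENNReal} [Fact (1 ≤ p)] {u : ℝ → X} (hu : MemSap p u) : MemBS p u :=
  ⟨hu.1, hu.2.bounded⟩

/-- A 1-periodic function in `L^p_loc` is bounded in the sense of Stepanov. -/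
theorem MemPeriodic.memBS {p : ENNReal} {u : ℝ → X} (hu : MemPeriodic p u) : MemBS p u := by
  obtain ⟨hl, hper⟩ := hu
  have hnat : ∀ n : ℕ, ∀ᵐ t : ℝ, u (t + n) = u t := by
    intro n
    induction n with
    | zero => simp
    | succ n ih =>
      have h1 := (measurePreserving_add_right volume (n : ℝ)).quasiMeasurePreserving.ae hper
      filter_upwards [h1, ih] with t h1 h2
      rw [← h2, ← h1]
      push_cast
      ring_nf
  have hint : ∀ n : ℤ, ∀ᵐ t : ℝ, u (t + n) = u t := by
    intro n
    obtain ⟨k, rfl | rfl⟩ := n.eq_nat_or_neg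
    · simpa using hnat k
    · have h1 := (measurePreserving_add_right volume (-(k : ℝ))).quasiMeasurePreserving.ae (hnat k)
      filter_upwards [h1] with t h1
      simpa using h1.symm
  refine ⟨hl, (eLpNorm u p (volume.restrict (Ioo 0 2))).toReal, ?_⟩
  rintro _ ⟨t, rfl⟩
  have hs : bochnerTransform u hl t = bochnerTransform u hl (Int.fract t) := by
    refine (MemLp.toLp_eq_toLp_iff _ _).2 ?_
    have h1 := (measurePreserving_add_left volume (Int.fract t)).quasiMeasurePreserving.ae
      (hint ⌊t⌋)
    refine ae_restrict_of_ae ?_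
    filter_upwards [h1] with θ h1
    rw [← h1]
    congr 1
    linarith [Int.fract_add_floor t]
  change ‖bochnerTransform u hl t‖ ≤ _
  rw [hs, bochnerTransform, Lp.norm_toLp]
  refine ENNReal.toReal_mono (hl 0 2).2.ne ?_
  have h2 := eLpNorm_comp_measurePreserving (p := p)
    (hl (Int.fract t) (Int.fract t + 1)).1 (measurePreserving_shift (Int.fract t))
  refine (le_of_eq h2).trans (eLpNorm_mono_measure _ (Measure.restrict_mono ?_ le_rfl))
  exact Ioo_subset_Ioo (Int.fract_nonneg t) (by linarith [Int.fract_lt_one t])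

/-- The space `BS^p(ℝ, X)` of functions bounded in the sense of Stepanov, where functions that are
equal almost everywhere are identified. -/
def BS (p : ENNReal) [Fact (1 ≤ p)] (X : Type*) [NormedAddCommGroup X] :
    AddSubgroup (ℝ →ₘ[volume] X) where
  carrier := {u | MemBS p u}
  zero_mem' := by
    have h : MemBS p (0 : ℝ → X) :=
      ⟨MemLpLoc.zero p, 0, by rintro _ ⟨t, rfl⟩; simp [bochnerTransform_zero]⟩
    exact h.congr AEEqFun.coeFn_zero.symm
  add_mem' := by
    rintro u v ⟨hu, C, hC⟩ ⟨hv, D, hD⟩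
    have h : MemBS p ((u : ℝ → X) + (v : ℝ → X)) := by
      refine ⟨hu.add hv, C + D, ?_⟩
      rintro _ ⟨t, rfl⟩
      exact (norm_add_le _ _).trans (add_le_add (hC ⟨t, rfl⟩) (hD ⟨t, rfl⟩))
    exact h.congr (AEEqFun.coeFn_add u v).symm
  neg_mem' := by
    rintro u ⟨hu, C, hC⟩
    have h : MemBS p (-(u : ℝ → X)) := by
      refine ⟨hu.neg, C, ?_⟩
      rintro _ ⟨t, rfl⟩
      exact ((congrArg norm (bochnerTransform_neg hu t)).trans (norm_neg _)).le.trans (hC ⟨t, rfl⟩)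
    exact h.congr (AEEqFun.coeFn_neg u).symm

/-- The Bochner transform on `BS^p(ℝ, X)`. -/
def BS.transform {p : ENNReal} [Fact (1 ≤ p)] (u : BS p X) (t : ℝ) : LpUnit p X :=
  bochnerTransform (u : ℝ →ₘ[volume] X) u.2.1 t

theorem BS.bddAbove {p : ENNReal} [Fact (1 ≤ p)] (u : BS p X) :
    BddAbove (range fun t => ‖BS.transform u t‖) :=
  u.2.2

theorem BS.transform_zero {p : ENNReal} [Fact (1 ≤ p)] (t : ℝ) :
    BS.transform (0 : BS p X) t = 0 :=
  (congrFun (bochnerTransform_congr _ (MemLpLoc.zero p) AEEqFun.coeFn_zero) t).trans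
    (bochnerTransform_zero t)

theorem BS.transform_add {p : ENNReal} [Fact (1 ≤ p)] (u v : BS p X) (t : ℝ) :
    BS.transform (u + v) t = BS.transform u t + BS.transform v t :=
  congrFun (bochnerTransform_congr _ (u.2.1.add v.2.1) (AEEqFun.coeFn_add u.1 v.1)) t

theorem BS.transform_neg {p : ENNReal} [Fact (1 ≤ p)] (u : BS p X) (t : ℝ) :
    BS.transform (-u) t = -BS.transform u t :=
  congrFun (bochnerTransform_congr _ u.2.1.neg (AEEqFun.coeFn_neg u.1)) t

theorem BS.eq_zero_of_transform {p : ENNReal} [Fact (1 ≤ p)] (u : BS p X)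
    (h : ∀ t, BS.transform u t = 0) : u = 0 := by
  have h1 : ∀ t : ℝ, ∀ᵐ s ∂(volume.restrict (Ioo t (t + 1))), (u : ℝ →ₘ[volume] X) s = 0 := by
    intro t
    have h2 := (MemLp.toLp_eq_toLp_iff (u.2.1.shift t) (MemLp.zero' (ε := X))).1 (h t)
    have h3 := (measurePreserving_sub_right volume t).quasiMeasurePreserving.ae
      ((ae_restrict_iff' measurableSet_Ioo).1 h2)
    refine (ae_restrict_iff' measurableSet_Ioo).2 ?_
    filter_upwards [h3] with s h3 hs
    simpa using h3 ⟨by linarith [hs.1], by linarith [hs.2]⟩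
  have h4 : ∀ᵐ s : ℝ, ∀ q : ℚ, s ∈ Ioo (q : ℝ) (q + 1) → (u : ℝ →ₘ[volume] X) s = 0 :=
    ae_all_iff.2 fun q => (ae_restrict_iff' measurableSet_Ioo).1 (h1 q)
  refine Subtype.ext (AEEqFun.ext ?_)
  refine Filter.EventuallyEq.trans ?_ AEEqFun.coeFn_zero.symm
  filter_upwards [h4] with s hs
  obtain ⟨q, hq1, hq2⟩ := exists_rat_btwn (sub_one_lt s)
  exact hs q ⟨hq2, by linarith⟩

/-- `BS^p(ℝ, X)` is normed by the Stepanov norm `‖u‖ = sup_t ‖u^b(t)‖`, the norms on the right being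
those of `L^p(0, 1; X)`. -/
instance (p : ENNReal) [Fact (1 ≤ p)] : NormedAddCommGroup (BS p X) :=
  AddGroupNorm.toNormedAddCommGroup
    { toFun := fun u => ⨆ t : ℝ, ‖BS.transform u t‖
      map_zero' := by simp [BS.transform_zero]
      add_le' := fun u v => ciSup_le fun t => by
        rw [BS.transform_add]
        exact (norm_add_le _ _).trans
          (add_le_add (le_ciSup (BS.bddAbove u) t) (le_ciSup (BS.bddAbove v) t))
      neg' := fun u => by simp [BS.transform_neg]
      eq_zero_of_map_eq_zero' := fun u hu => BS.eq_zero_of_transform u fun t =>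
        norm_le_zero_iff.1 ((le_ciSup (BS.bddAbove u) t).trans hu.le) }

theorem BS.norm_def {p : ENNReal} [Fact (1 ≤ p)] (u : BS p X) :
    ‖u‖ = ⨆ t : ℝ, ‖BS.transform u t‖ :=
  rfl

/-- The space `S^p_ap(ℝ, X)` of Stepanov almost periodic functions, with the Stepanov norm. It is
contained in `BS^p(ℝ, X)` by `MemSap.memBS`. -/
def Sap (p : ENNReal) [Fact (1 ≤ p)] (X : Type*) [NormedAddCommGroup X] : Set (BS p X) :=
  {u | MemSap p (u : ℝ →ₘ[volume] X)}

/-- The space `L^p_1(ℝ, X)` of 1-periodic functions in `L^p_loc`, with the Stepanov norm. It is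
contained in `BS^p(ℝ, X)` by `MemPeriodic.memBS`. -/
def LpPeriodic (p : ENNReal) [Fact (1 ≤ p)] (X : Type*) [NormedAddCommGroup X] : Set (BS p X) :=
  {u | MemPeriodic p (u : ℝ →ₘ[volume] X)}

end Spaces

/-- The Nemytskii operator built on `f`, acting on functions: `t ↦ f(t, u(t))`. -/
def nemytskii {X Y : Type*} (f : ℝ → X → Y) (u : ℝ → X) : ℝ → Y :=
  fun t => f t (u t)

/-- The Nemytskii operator of `f` is a well-defined continuous map from `A ⊆ BS^p(ℝ, X)` into
`B ⊆ BS^q(ℝ, Y)`: for each `u ∈ A` the function `t ↦ f(t, u(t))` is (almost everywhere equal to) an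
element of `B`, and the map `A → B` so obtained is continuous for the Stepanov norms. Equality of
classes does not depend on the representative of `u`. -/
def NemytskiiContinuous {X Y : Type*} [NormedAddCommGroup X] [NormedAddCommGroup Y]
    {p q : ENNReal} [Fact (1 ≤ p)] [Fact (1 ≤ q)] (f : ℝ → X → Y)
    (A : Set (BS p X)) (B : Set (BS q Y)) : Prop :=
  ∃ N : A → B, Continuous N ∧
    ∀ u : A, ((N u : BS q Y) : ℝ →ₘ[volume] Y) =ᵐ[volume]
      nemytskii f ((u : BS p X) : ℝ →ₘ[volume] X)

end Stepanov

end

/-!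
Only the passage from periodic to almost periodic functions has content: periodic functions are
Stepanov almost periodic because translation is continuous in `L^p` (`MemPeriodic.memSap`), and
testing the operator on constants gives the almost periodicity of the sections `f(·, x)`
(`NemytskiiContinuous.memSap_const`).

For the converse (`nemytskiiContinuous_sap`), no regularity of `f` is needed, only the fact that a
Nemytskii operator is local. Extending a function on `(t, t + 1)` periodically, one sees that `N_f`
induces operators `F t : L^p(0, 1; X) → L^q(0, 1; Y)`, `F t v = f(t + ·, v(·))`
(`localOperator`), and `(N_f u)^b(t) = F t (u^b(t))` for every `u`
(`exists_bochnerTransform_nemytskii`). Two facts about `F` suffice.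

* The operators `F t` are equicontinuous at the points of a compact set, uniformly in `t ∈ ℝ`
  (`exists_forall_norm_localOperator_sub_le`). Indeed the periodic extension of `v` from `(t, t + 1)`
  is isometric in `v`, continuous in `(t, v)` and of period 1 in `t`, so that the extensions of the
  members of a compact set form again a compact set, at which `N_f` is uniformly continuous.
* For fixed `v`, the function `t ↦ F t v` is almost periodic (`isAlmostPeriodic_of_const`). For
  constant `v` this is the hypothesis on the sections `f(·, x)`; simple functions follow by locality,
  and all of `L^p` by equicontinuity.

Now let `u` be Stepanov almost periodic. The range of `u^b` is relatively compact, and finitely many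
almost periodic functions have common almost periods (`IsAlmostPeriodic.pi`); combining this for
`u^b` and for the functions `F · v`, where `v` runs through a finite net of the range, one finds that
`t ↦ F t (u^b(t))` is almost periodic (`IsAlmostPeriodic.comp_of_equicontinuous`). Continuity of
`N_f` at `u` is the equicontinuity on the closure of the range of `u^b`.
-/

noncomputable section

namespace Stepanov

open Filter Topology

/-! ### Almost periodic functions -/

section AlmostPeriodic

variable {E : Type*} [NormedAddCommGroup E] {F : Type*} [NormedAddCommGroup F]

theorem almostPeriods_mono {g : ℝ → E} {h : ℝ → F} {δ ε : ℝ}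
    (H : ∀ s t, ‖g s - g t‖ ≤ δ → ‖h s - h t‖ ≤ ε) : almostPeriods g δ ⊆ almostPeriods h ε :=
  fun _ hτ t => H _ _ (hτ t)

theorem RelativelyDense.mono {D D' : Set ℝ} (hD : RelativelyDense D) (h : D ⊆ D') :
    RelativelyDense D' :=
  let ⟨l, hl, H⟩ := hD
  ⟨l, hl, fun a => (H a).mono (inter_subset_inter_left _ h)⟩

/-- A function is almost periodic as soon as, for each `ε`, its variation is controlled up to `ε` by
that of some almost periodic function. -/
theorem IsAlmostPeriodic.of_forall {h : ℝ → F}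
    (H : ∀ ε : ℝ, 0 < ε → ∃ (E : Type*) (_ : NormedAddCommGroup E) (g : ℝ → E),
      IsAlmostPeriodic g ∧ ∃ δ > 0, ∀ s t, ‖g s - g t‖ ≤ δ → ‖h s - h t‖ ≤ ε) :
    IsAlmostPeriodic h := by
  refine ⟨?_, fun ε hε => ?_⟩
  · refine continuous_iff_continuousAt.2 fun t => Metric.tendsto_nhds.2 fun ε hε => ?_
    obtain ⟨E, _, g, hg, δ, hδ, Hg⟩ := H (ε / 2) (half_pos hε)
    filter_upwards [Metric.tendsto_nhds.1 (hg.1.tendsto t) δ hδ] with s hs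
    rw [dist_eq_norm] at hs ⊢
    exact (Hg s t hs.le).trans_lt (half_lt_self hε)
  · obtain ⟨E, _, g, hg, δ, hδ, Hg⟩ := H ε hε
    exact (hg.2 δ hδ).mono (almostPeriods_mono Hg)

theorem sub_mem_almostPeriods {g : ℝ → E} {δ ε a b : ℝ} (ha : a ∈ almostPeriods g δ)
    (hb : b ∈ almostPeriods g ε) : a - b ∈ almostPeriods g (δ + ε) := by
  intro t
  have h1 := ha (t - b)
  have h2 := hb (t - b)
  rw [sub_add_cancel, norm_sub_rev] at h2
  rw [show t - b + a = t + (a - b) by ring] at h1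
  calc _ = ‖(g (t + (a - b)) - g (t - b)) + (g (t - b) - g t)‖ := by rw [sub_add_sub_cancel]
    _ ≤ _ := (norm_add_le _ _).trans (add_le_add h1 h2)

theorem neg_mem_almostPeriods {g : ℝ → E} {ε a : ℝ} (ha : a ∈ almostPeriods g ε) :
    -a ∈ almostPeriods g ε := by
  intro t
  have h := ha (t + -a)
  rwa [neg_add_cancel_right, norm_sub_rev] at h

/-- Almost periodic functions are uniformly continuous: small numbers are almost periods. -/
theorem IsAlmostPeriodic.exists_small_almostPeriods {g : ℝ → E} (hg : IsAlmostPeriodic g) {ε : ℝ}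
    (hε : 0 < ε) : ∃ δ > 0, ∀ η : ℝ, |η| ≤ δ → η ∈ almostPeriods g ε := by
  obtain ⟨l, hl, hD⟩ := hg.2 (ε / 3) (by positivity)
  have hK := (isCompact_Icc (a := (-1 : ℝ)) (b := l + 1)).uniformContinuousOn_of_continuous
    hg.1.continuousOn
  obtain ⟨δ, hδ, h⟩ := Metric.uniformContinuousOn_iff.1 hK (ε / 3) (by positivity)
  refine ⟨min (δ / 2) 1, by positivity, fun η hη t => ?_⟩
  have hη1 := abs_le.1 (hη.trans (min_le_right _ _))
  have hη2 : |η| < δ := (hη.trans (min_le_left _ _)).trans_lt (half_lt_self hδ)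
  -- An almost period takes `t` into `[0, l]` and `t + η` into the compact interval `[-1, l + 1]`.
  obtain ⟨τ, hτ, h1, h2⟩ := hD (-t)
  have h3 := h (t + η + τ) ⟨by linarith, by linarith⟩ (t + τ) ⟨by linarith, by linarith⟩
    (by rw [Real.dist_eq]; convert hη2 using 2; ring)
  rw [dist_eq_norm] at h3
  have h4 := hτ (t + η)
  rw [norm_sub_rev] at h4
  have h5 := hτ t
  calc _ = ‖(g (t + η) - g (t + η + τ)) + (g (t + η + τ) - g (t + τ)) + (g (t + τ) - g t)‖ := by
        congr 1; abel
    _ ≤ ε / 3 + ε / 3 + ε / 3 := (norm_add₃_le).trans (by gcongr)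
    _ = ε := by ring

/-- A set of reals is syndetic if finitely many of its translates cover the line. -/
def Syndetic (A : Set ℝ) : Prop :=
  ∃ S : Set ℝ, S.Finite ∧ ∀ s : ℝ, ∃ r ∈ S, s - r ∈ A

theorem Syndetic.relativelyDense {A : Set ℝ} (hA : Syndetic A) : RelativelyDense A := by
  obtain ⟨S, hS, H⟩ := hA
  obtain ⟨M, hM⟩ := hS.isBounded.exists_norm_le
  refine ⟨2 * |M| + 1, by positivity, fun a => ?_⟩
  obtain ⟨r, hr, h⟩ := H (a + |M|)
  have := abs_le.1 ((hM r hr).trans (le_abs_self M))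
  exact ⟨_, h, by linarith, by linarith⟩

/-- Half of Bochner's criterion: the translates of an almost periodic function form a totally
bounded family for the uniform norm. -/
theorem IsAlmostPeriodic.syndetic {g : ℝ → E} (hg : IsAlmostPeriodic g) {ε : ℝ} (hε : 0 < ε) :
    Syndetic (almostPeriods g ε) := by
  obtain ⟨l, hl, hD⟩ := hg.2 (ε / 2) (by positivity)
  obtain ⟨δ, hδ, hη⟩ := hg.exists_small_almostPeriods (half_pos hε)
  obtain ⟨S, -, hS, hcov⟩ := (isCompact_Icc (a := (0 : ℝ)) (b := l)).finite_cover_balls hδ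
  refine ⟨S, hS, fun s => ?_⟩
  -- Up to an almost period, `s` lies in `[0, l]`, and small numbers are almost periods.
  obtain ⟨τ, hτ, h1, h2⟩ := hD (s - l)
  obtain ⟨r, hr, h3⟩ := mem_iUnion₂.1 (hcov (show s - τ ∈ Icc 0 l from ⟨by linarith, by linarith⟩))
  rw [Metric.mem_ball, Real.dist_eq] at h3
  refine ⟨r, hr, ?_⟩
  have h4 := sub_mem_almostPeriods (hη _ h3.le) (neg_mem_almostPeriods hτ)
  rw [add_halves] at h4
  convert h4 using 1
  ring

/-- Finitely many syndetic sets have a common syndetic set of differences. This replaces the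
intersection, which may well be empty. -/
theorem syndetic_iInter_sub {ι : Type*} [Finite ι] {A : ι → Set ℝ} (hA : ∀ i, Syndetic (A i)) :
    Syndetic {τ | ∀ i, ∃ a ∈ A i, ∃ b ∈ A i, τ = a - b} := by
  choose S hS H using hA
  choose c hc hcA using H
  -- The vector `C s` of covering translates takes finitely many values. Two reals with the same value
  -- differ by an element of each `A i - A i`, so one representative for each value is enough.
  let C : ℝ → ∀ i, ℝ := fun s i => c i s
  have hfin : (range C).Finite :=
    (Set.Finite.pi' hS).subset (by rintro _ ⟨s, rfl⟩ i; exact hc i s)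
  have := hfin.to_subtype
  refine ⟨range (rangeSplitting C), finite_range _, fun s => ⟨_, ⟨⟨C s, s, rfl⟩, rfl⟩, fun i => ?_⟩⟩
  have h := congrFun (apply_rangeSplitting C ⟨C s, s, rfl⟩) i
  refine ⟨_, hcA i s, _, hcA i (rangeSplitting C ⟨C s, s, rfl⟩), ?_⟩
  change c i _ = c i s at h
  rw [h]
  ring

/-- A finite family of almost periodic functions has common almost periods. -/
theorem IsAlmostPeriodic.pi {ι : Type*} [Fintype ι] {E : ι → Type*}
    [∀ i, NormedAddCommGroup (E i)] {g : ∀ i, ℝ → E i} (hg : ∀ i, IsAlmostPeriodic (g i)) :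
    IsAlmostPeriodic fun t i => g i t := by
  refine ⟨continuous_pi fun i => (hg i).1, fun ε hε => ?_⟩
  refine (syndetic_iInter_sub fun i => (hg i).syndetic (half_pos hε)).relativelyDense.mono ?_
  intro τ hτ t
  refine (pi_norm_le_iff_of_nonneg hε.le).2 fun i => ?_
  obtain ⟨a, ha, b, hb, rfl⟩ := hτ i
  simpa using sub_mem_almostPeriods ha hb t

theorem IsAlmostPeriodic.prodMk {g : ℝ → E} {h : ℝ → F} (hg : IsAlmostPeriodic g)
    (hh : IsAlmostPeriodic h) : IsAlmostPeriodic fun t => (g t, h t) := by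
  refine ⟨hg.1.prodMk hh.1, fun ε hε => ?_⟩
  let A : Bool → Set ℝ := fun b => cond b (almostPeriods g (ε / 2)) (almostPeriods h (ε / 2))
  have hA : ∀ b, Syndetic (A b) := by
    rintro (_ | _)
    exacts [hh.syndetic (half_pos hε), hg.syndetic (half_pos hε)]
  refine (syndetic_iInter_sub hA).relativelyDense.mono ?_
  intro τ hτ t
  rw [Prod.mk_sub_mk, Prod.norm_mk, max_le_iff]
  constructor
  · obtain ⟨a, ha, b, hb, rfl⟩ := hτ true
    simpa using sub_mem_almostPeriods ha hb t
  · obtain ⟨a, ha, b, hb, rfl⟩ := hτ false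
    simpa using sub_mem_almostPeriods ha hb t

/-- The range of an almost periodic function with values in a complete space is relatively compact. -/
theorem IsAlmostPeriodic.isCompact_closure_range [CompleteSpace E] {g : ℝ → E}
    (hg : IsAlmostPeriodic g) : IsCompact (closure (range g)) := by
  refine TotallyBounded.isCompact_of_isClosed (TotallyBounded.closure ?_) isClosed_closure
  refine Metric.totallyBounded_iff.2 fun ε hε => ?_
  obtain ⟨S, hS, H⟩ := hg.syndetic (half_pos hε)
  refine ⟨g '' S, hS.image g, ?_⟩
  rintro _ ⟨s, rfl⟩
  obtain ⟨r, hr, h⟩ := H s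
  refine mem_iUnion₂.2 ⟨g r, mem_image_of_mem g hr, ?_⟩
  have h1 := h r
  rw [add_sub_cancel] at h1
  rw [Metric.mem_ball, dist_eq_norm]
  exact h1.trans_lt (half_lt_self hε)

/-- Let `Φ t v` be almost periodic in `t` for each `v`, and equicontinuous in `v`, uniformly in `t`, at
the points of the closure of the range of an almost periodic function `g`. Then `Φ t (g t)` is almost
periodic: almost periods common to `g` and to `Φ · v`, for `v` in a finite net of the range of `g`,
are almost periods of the composition. -/
theorem IsAlmostPeriodic.comp_of_equicontinuous [CompleteSpace E] {g : ℝ → E} {Φ : ℝ → E → F}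
    (hg : IsAlmostPeriodic g) (hΦ : ∀ v, IsAlmostPeriodic fun t => Φ t v)
    (H : ∀ ε : ℝ, 0 < ε → ∃ δ > 0, ∀ v ∈ closure (range g), ∀ w, ‖v - w‖ ≤ δ →
      ∀ t, ‖Φ t v - Φ t w‖ ≤ ε) :
    IsAlmostPeriodic fun t => Φ t (g t) := by
  refine .of_forall fun ε hε => ?_
  obtain ⟨δ, hδ, h⟩ := H (ε / 4) (by positivity)
  obtain ⟨S, -, hS, hcov⟩ := hg.isCompact_closure_range.finite_cover_balls hδ
  have := hS.fintype
  refine ⟨E × (S → F), inferInstance, _, hg.prodMk (IsAlmostPeriodic.pi fun v : S => hΦ v),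
    min δ (ε / 4), by positivity, fun s t hst => ?_⟩
  have hs := subset_closure (mem_range_self (f := g) s)
  have ht := subset_closure (mem_range_self (f := g) t)
  obtain ⟨v, hv, htv⟩ := mem_iUnion₂.1 (hcov ht)
  rw [Metric.mem_ball, dist_eq_norm] at htv
  rw [Prod.mk_sub_mk, Prod.norm_mk, max_le_iff, le_min_iff, le_min_iff] at hst
  have h1 := h _ hs (g t) hst.1.1 s
  have h2 := h _ ht v htv.le s
  have h3 := (norm_le_pi_norm _ ⟨v, hv⟩).trans hst.2.2
  have h4 := h _ ht v htv.le t
  rw [norm_sub_rev] at h4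
  calc ‖Φ s (g s) - Φ t (g t)‖
      = ‖((Φ s (g s) - Φ s (g t)) + (Φ s (g t) - Φ s v)) + ((Φ s v - Φ t v)
          + (Φ t v - Φ t (g t)))‖ := by congr 1; abel
    _ ≤ (ε / 4 + ε / 4) + (ε / 4 + ε / 4) := (norm_add_le _ _).trans
        (add_le_add (norm_add_le_of_le h1 h2) (norm_add_le_of_le h3 h4))
    _ = ε := by ring

end AlmostPeriodic

/-! ### The Bochner transform -/

section Transform

variable {X : Type*} [NormedAddCommGroup X] {p : ENNReal}

theorem MemLpLoc.of_unit_intervals {u : ℝ → X}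
    (hu : ∀ t, MemLp u p (volume.restrict (Ioo t (t + 1)))) : MemLpLoc p u := by
  have key : ∀ (a : ℝ) (n : ℕ), MemLp u p (volume.restrict (Ioc a (a + n))) := by
    intro a n
    induction n with
    | zero => simp
    | succ n ih =>
      have h1 := hu (a + n)
      rw [Measure.restrict_congr_set Ioo_ae_eq_Ioc] at h1
      have h2 : Ioc a (a + ↑(n + 1)) = Ioc a (a + n) ∪ Ioc (a + n) (a + n + 1) := by
        rw [Ioc_union_Ioc_eq_Ioc (by simp) (by simp)]
        push_cast
        ring_nf
      have h3 : Disjoint (Ioc a (a + n)) (Ioc (a + n) (a + n + 1)) :=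
        Ioc_disjoint_Ioc_of_le le_rfl
      rw [← memLp_indicator_iff_restrict measurableSet_Ioc] at h1 ih ⊢
      rw [h2, indicator_union_of_disjoint h3]
      exact ih.add h1
  intro a b
  obtain ⟨n, hn⟩ := exists_nat_ge (b - a)
  refine (key a n).mono_measure (Measure.restrict_mono ?_ le_rfl)
  exact fun s hs => ⟨hs.1, by linarith [hs.2]⟩

theorem eLpNorm_shift {u : ℝ → X} (hu : MemLpLoc p u) (t : ℝ) :
    eLpNorm (fun θ => u (t + θ)) p (volume.restrict (Ioo (0 : ℝ) 1)) =
      eLpNorm u p (volume.restrict (Ioo t (t + 1))) :=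
  eLpNorm_comp_measurePreserving (hu t (t + 1)).1 (measurePreserving_shift t)

variable [Fact (1 ≤ p)]

/-- The Bochner transform of a locally `p`-integrable function is continuous. Near a given point it
is read off the translates of a compactly supported truncation, which depend continuously on the
translation in `L^p(ℝ, X)`. -/
theorem continuous_bochnerTransform (hp : p ≠ ⊤) {u : ℝ → X} (hu : MemLpLoc p u) :
    Continuous (bochnerTransform u hu) := by
  refine continuous_iff_continuousAt.2 fun t₀ => ?_
  set I := Ioo (t₀ - 1) (t₀ + 2)
  have hw : MemLp (I.indicator u) p volume :=
    (memLp_indicator_iff_restrict measurableSet_Ioo).2 (hu _ _)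
  let φ : ℝ → C(ℝ, ℝ) := fun t => ⟨fun θ => t + θ, by fun_prop⟩
  have hφ : Continuous φ := ContinuousMap.continuous_of_continuous_uncurry _ (by
    change Continuous fun x : ℝ × ℝ => x.1 + x.2
    fun_prop)
  have hmp : ∀ t, MeasurePreserving (φ t) volume volume := fun t =>
    measurePreserving_add_left volume t
  have hc := (continuous_const (y := hw.toLp _)).compMeasurePreservingLp hφ hmp hp
  have hc0 := tendsto_iff_norm_sub_tendsto_zero.1 (hc.tendsto t₀)
  refine tendsto_iff_norm_sub_tendsto_zero.2 (squeeze_zero' (.of_forall fun _ => norm_nonneg _)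
    ?_ hc0)
  filter_upwards [Ioo_mem_nhds (sub_one_lt t₀) (lt_add_one t₀)] with t ht
  rw [bochnerTransform, bochnerTransform, ← MemLp.toLp_sub, Lp.norm_toLp,
    Lp.toLp_compMeasurePreserving, Lp.toLp_compMeasurePreserving, ← MemLp.toLp_sub, Lp.norm_toLp]
  have hfin := ((hw.comp_measurePreserving (hmp t)).sub (hw.comp_measurePreserving (hmp t₀))).2.ne
  refine ENNReal.toReal_mono hfin ?_
  refine le_trans (le_of_eq (eLpNorm_congr_ae ?_)) (eLpNorm_mono_measure _ Measure.restrict_le_self)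
  refine (ae_restrict_iff' measurableSet_Ioo).2 (.of_forall fun θ hθ => ?_)
  have h1 : t + θ ∈ I := ⟨by linarith [ht.1, hθ.1], by linarith [ht.2, hθ.2]⟩
  have h2 : t₀ + θ ∈ I := ⟨by linarith [hθ.1], by linarith [hθ.2]⟩
  simp [φ, h1, h2]

theorem MemSap.congr {u v : ℝ → X} (hu : MemSap p u) (h : u =ᵐ[volume] v) : MemSap p v := by
  obtain ⟨hl, hb⟩ := hu
  exact ⟨hl.congr h, by rwa [← bochnerTransform_congr hl (hl.congr h) h]⟩

theorem BS.norm_transform_le (u : BS p X) (t : ℝ) : ‖BS.transform u t‖ ≤ ‖u‖ :=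
  le_ciSup (BS.bddAbove u) t

theorem BS.transform_sub (u v : BS p X) (t : ℝ) :
    BS.transform (u - v) t = BS.transform u t - BS.transform v t := by
  rw [sub_eq_add_neg, BS.transform_add, BS.transform_neg, ← sub_eq_add_neg]

/-- The element of `BS^p(ℝ, X)` given by a function. -/
def MemBS.toBS {u : ℝ → X} (hu : MemBS p u) : BS p X :=
  ⟨AEEqFun.mk u (by
    have h : ∀ n : ℕ, AEStronglyMeasurable u (volume.restrict (Ioo (-(n : ℝ)) n)) :=
      fun n => (hu.1 _ _).1
    have h1 := (aestronglyMeasurable_iUnion_iff (μ := volume)).2 h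
    have h2 : (⋃ n : ℕ, Ioo (-(n : ℝ)) n) = univ := by
      refine eq_univ_of_forall fun x => ?_
      obtain ⟨n, hn⟩ := exists_nat_gt |x|
      exact mem_iUnion.2 ⟨n, abs_lt.1 hn⟩
    rwa [h2, Measure.restrict_univ] at h1), hu.congr (AEEqFun.coeFn_mk _ _).symm⟩

theorem MemBS.coeFn_toBS {u : ℝ → X} (hu : MemBS p u) :
    ((hu.toBS : BS p X) : ℝ →ₘ[volume] X) =ᵐ[volume] u :=
  AEEqFun.coeFn_mk _ _

theorem MemBS.transform_toBS {u : ℝ → X} (hu : MemBS p u) :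
    BS.transform hu.toBS = bochnerTransform u hu.1 :=
  bochnerTransform_congr hu.toBS.2.1 hu.1 hu.coeFn_toBS

theorem BS.coeFn_transform (u : BS p X) (t : ℝ) :
    BS.transform u t =ᵐ[volume.restrict (Ioo (0 : ℝ) 1)]
      fun θ => (u : ℝ →ₘ[volume] X) (t + θ) :=
  (u.2.1.shift t).coeFn_toLp

end Transform

/-! ### Periodic functions -/

section Periodic

/-- The fractional part preserves the measure of every interval of length one. -/
theorem measurePreserving_fract (a : ℝ) :
    MeasurePreserving (Int.fract : ℝ → ℝ) (volume.restrict (Ioo a (a + 1)))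
      (volume.restrict (Ioo (0 : ℝ) 1)) := by
  refine ⟨measurable_fract, Measure.ext fun B hB => ?_⟩
  have hA : MeasurableSet ((Int.fract : ℝ → ℝ) ⁻¹' B) := measurable_fract hB
  rw [Measure.map_apply measurable_fract hB, Measure.restrict_congr_set Ioo_ae_eq_Ioc,
    Measure.restrict_apply hA]
  -- The preimage of `B` is invariant under integer translations, so `a` may be replaced by `0`.
  have h1 := (isAddFundamentalDomain_Ioc one_pos a volume).measure_set_eq
    (isAddFundamentalDomain_Ioc one_pos 0 volume) hA (by
      rintro ⟨_, n, rfl⟩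
      ext x
      have : ((n : ℝ) + x) = x + n := add_comm _ _
      simp [AddSubgroup.vadd_def, this])
  rw [h1, zero_add, ← Measure.restrict_apply hA, ← Measure.restrict_congr_set Ioo_ae_eq_Ioc,
    Measure.restrict_apply hA, Measure.restrict_apply hB]
  congr 1
  ext x
  simp only [mem_inter_iff, mem_preimage]
  refine and_congr_left fun hx => ?_
  rw [Int.fract_eq_self.2 ⟨hx.1.le, hx.2⟩]

theorem ae_add_int_eq {Z : Type*} {u : ℝ → Z} (hu : ∀ᵐ t : ℝ, u (t + 1) = u t) :
    ∀ᵐ t : ℝ, ∀ n : ℤ, u (t + n) = u t := by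
  have h : ∀ᵐ t : ℝ, ∀ n : ℤ, u (t + n + 1) = u (t + n) :=
    ae_all_iff.2 fun n => (measurePreserving_add_right volume (n : ℝ)).quasiMeasurePreserving.ae hu
  filter_upwards [h] with t ht n
  induction n using Int.induction_on with
  | zero => simp
  | succ n ih =>
    refine Eq.trans ?_ ((ht n).trans ih)
    push_cast
    rw [add_assoc]
  | pred n ih =>
    rw [← ih, ← ht]
    push_cast
    ring_nf

theorem ae_eq_comp_fract {Z : Type*} {u : ℝ → Z} (hu : ∀ᵐ t : ℝ, u (t + 1) = u t) :
    u =ᵐ[volume] fun t => u (Int.fract t) := by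
  filter_upwards [ae_add_int_eq hu] with t ht
  rw [← ht (-⌊t⌋), Int.fract]
  push_cast
  rw [sub_eq_add_neg]

variable {X : Type*} [NormedAddCommGroup X] {p : ENNReal}

theorem MemPeriodic.norm_bochnerTransform {u : ℝ → X} (hu : MemPeriodic p u) (s t : ℝ) :
    ‖bochnerTransform u hu.1 s‖ = ‖bochnerTransform u hu.1 t‖ := by
  have key : ∀ t, eLpNorm u p (volume.restrict (Ioo t (t + 1))) =
      eLpNorm u p (volume.restrict (Ioo 0 1)) := fun t =>
    (eLpNorm_congr_ae (ae_restrict_of_ae (ae_eq_comp_fract hu.2))).trans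
      (eLpNorm_comp_measurePreserving (hu.1 0 1).1 (measurePreserving_fract t))
  rw [bochnerTransform, bochnerTransform, Lp.norm_toLp, Lp.norm_toLp, eLpNorm_shift hu.1,
    eLpNorm_shift hu.1, key s, key t]

theorem MemPeriodic.const (x : X) : MemPeriodic p fun _ : ℝ => x :=
  ⟨fun _ _ => memLp_const x, .of_forall fun _ => rfl⟩

theorem memPeriodic_comp_fract (t : ℝ) (v : LpUnit p X) :
    MemPeriodic p fun s => v (Int.fract (s - t)) := by
  refine ⟨.of_unit_intervals fun a => ?_, .of_forall fun s => ?_⟩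
  · have h := (measurePreserving_fract (a - t)).comp
      (g := Int.fract) (f := fun s : ℝ => s - t) (μa := volume.restrict (Ioo a (a + 1))) (by
        have h := (measurePreserving_sub_right (volume : Measure ℝ) t).restrict_preimage
          (measurableSet_Ioo (a := a - t) (b := a - t + 1))
        simpa [sub_add_eq_add_sub] using h)
    exact (Lp.memLp v).comp_measurePreserving h
  · simp only
    rw [add_sub_right_comm, Int.fract_add_one]

variable [Fact (1 ≤ p)]

theorem MemPeriodic.memSap (hp : p ≠ ⊤) {u : ℝ → X} (hu : MemPeriodic p u) : MemSap p u := by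
  refine ⟨hu.1, continuous_bochnerTransform hp hu.1, fun ε hε => ⟨1, one_pos, fun a => ?_⟩⟩
  refine ⟨⌈a⌉, fun t => ?_, Int.le_ceil a, (Int.ceil_lt_add_one a).le⟩
  have h : bochnerTransform u hu.1 (t + ⌈a⌉) = bochnerTransform u hu.1 t := by
    refine (MemLp.toLp_eq_toLp_iff _ _).2 ?_
    have h1 := shift_ae_eq (u := fun t => u (t + ⌈a⌉)) (v := u)
      ((ae_add_int_eq hu.2).mono fun t ht => ht _) t
    filter_upwards [h1] with θ h1
    rw [← h1]
    ring_nf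
  rw [h, sub_self, norm_zero]
  exact hε.le

/-- The Stepanov norm of a periodic function is its `L^p` norm over any period. -/
theorem norm_eq_of_mem_lpPeriodic {u : BS p X} (hu : u ∈ LpPeriodic p X) (t : ℝ) :
    ‖u‖ = ‖BS.transform u t‖ := by
  have h : ∀ s, ‖BS.transform u s‖ = ‖BS.transform u t‖ := fun s =>
    MemPeriodic.norm_bochnerTransform (p := p) hu s t
  rw [BS.norm_def]
  simp_rw [h, ciSup_const]

theorem sub_mem_lpPeriodic {u v : BS p X} (hu : u ∈ LpPeriodic p X) (hv : v ∈ LpPeriodic p X) :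
    u - v ∈ LpPeriodic p X := by
  refine ⟨(u - v).2.1, ?_⟩
  have h : ((u - v : BS p X) : ℝ →ₘ[volume] X) =ᵐ[volume]
    ((u : ℝ →ₘ[volume] X) - (v : ℝ →ₘ[volume] X) : ℝ → X) := AEEqFun.coeFn_sub u.1 v.1
  have h' := (measurePreserving_add_right volume (1 : ℝ)).quasiMeasurePreserving.ae h
  filter_upwards [h, h', hu.2, hv.2] with t h1 h2 h3 h4
  rw [h1, h2, Pi.sub_apply, Pi.sub_apply, h3, h4]

/-- The 1-periodic function on the line which equals `v` on the interval `(t, t + 1)`, that is, whose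
Bochner transform takes the value `v` at `t`. -/
def periodicExtension (t : ℝ) (v : LpUnit p X) : LpPeriodic p X :=
  ⟨(memPeriodic_comp_fract t v).memBS.toBS, by
    have h := (memPeriodic_comp_fract t v).memBS.coeFn_toBS
    have h' := (measurePreserving_add_right volume (1 : ℝ)).quasiMeasurePreserving.ae h
    refine ⟨((memPeriodic_comp_fract t v).memBS.toBS).2.1, ?_⟩
    filter_upwards [h, h', (memPeriodic_comp_fract t v).2] with s h1 h2 h3
    rw [h1, h2, h3]⟩

theorem coeFn_periodicExtension (t : ℝ) (v : LpUnit p X) :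
    ((periodicExtension t v : BS p X) : ℝ →ₘ[volume] X) =ᵐ[volume]
      fun s => v (Int.fract (s - t)) :=
  (memPeriodic_comp_fract t v).memBS.coeFn_toBS

theorem transform_periodicExtension_self (t : ℝ) (v : LpUnit p X) :
    BS.transform (periodicExtension t v : BS p X) t = v := by
  refine (congrFun (memPeriodic_comp_fract t v).memBS.transform_toBS t).trans (Lp.ext ?_)
  refine (MemLp.coeFn_toLp _).trans ?_
  refine (ae_restrict_iff' measurableSet_Ioo).2 (.of_forall fun θ hθ => ?_)
  simp only
  rw [add_sub_cancel_left, Int.fract_eq_self.2 ⟨hθ.1.le, hθ.2⟩]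

theorem periodicExtension_fract (t : ℝ) (v : LpUnit p X) :
    periodicExtension (Int.fract t) v = periodicExtension t v := by
  refine Subtype.ext (Subtype.ext (AEEqFun.ext ?_))
  refine (coeFn_periodicExtension _ v).trans
    (.trans (.of_forall fun s => ?_) (coeFn_periodicExtension _ v).symm)
  simp only
  congr 1
  rw [show s - Int.fract t = s - t + ⌊t⌋ by rw [Int.fract]; ring, Int.fract_add_intCast]

theorem isometry_periodicExtension (t : ℝ) :
    Isometry (periodicExtension t : LpUnit p X → LpPeriodic p X) := by
  refine Isometry.of_dist_eq fun v w => ?_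
  rw [Subtype.dist_eq, dist_eq_norm, dist_eq_norm,
    norm_eq_of_mem_lpPeriodic (sub_mem_lpPeriodic (Subtype.mem _) (Subtype.mem _)) t,
    BS.transform_sub, transform_periodicExtension_self, transform_periodicExtension_self]

theorem continuous_periodicExtension (hp : p ≠ ⊤) :
    Continuous fun a : ℝ × LpUnit p X => periodicExtension a.1 a.2 := by
  refine continuous_prod_of_continuous_lipschitzWith' _ 1
    (fun t => (isometry_periodicExtension t).lipschitz) fun v => ?_
  -- Translating the periodic function by `t` amounts to evaluating its Bochner transform at `-t`.
  have hc := (continuous_bochnerTransform hp (memPeriodic_comp_fract 0 v).1).comp continuous_neg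
  have h0 : ∀ t, BS.transform (periodicExtension t v : BS p X) 0 =
      bochnerTransform _ (memPeriodic_comp_fract 0 v).1 (-t) := by
    intro t
    refine (congrFun (memPeriodic_comp_fract t v).memBS.transform_toBS 0).trans ?_
    simp only [bochnerTransform]
    congr 1
    ext θ
    ring_nf
  refine continuous_iff_continuousAt.2 fun t₀ => tendsto_iff_dist_tendsto_zero.2 ?_
  refine (tendsto_iff_dist_tendsto_zero.1 (hc.tendsto t₀)).congr fun t => ?_
  rw [Subtype.dist_eq, dist_eq_norm, dist_eq_norm,
    norm_eq_of_mem_lpPeriodic (sub_mem_lpPeriodic (Subtype.mem _) (Subtype.mem _)) 0,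
    BS.transform_sub, h0, h0]
  rfl

end Periodic

/-! ### Nemytskii operators -/

section Nemytskii

variable {X Y : Type*} [NormedAddCommGroup X] [NormedAddCommGroup Y] {p q : ENNReal}
  {f : ℝ → X → Y}

/-- Let `F t` be the operators `v ↦ f(t + ·, v(·))`. If `v` takes at almost every point the value of
`v₁` or that of `v₂`, then `F t v` inherits almost
periodicity in `t` from `F t v₁` and `F t v₂`. -/
theorem isAlmostPeriodic_of_ae_eq_or [Fact (1 ≤ q)] {F : ℝ → LpUnit p X → LpUnit q Y}
    (hF : ∀ t v, F t v =ᵐ[volume.restrict (Ioo (0 : ℝ) 1)] fun θ => f (t + θ) (v θ))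
    {v v₁ v₂ : LpUnit p X} (h₁ : IsAlmostPeriodic fun t => F t v₁)
    (h₂ : IsAlmostPeriodic fun t => F t v₂)
    (hv : ∀ᵐ θ ∂(volume.restrict (Ioo (0 : ℝ) 1)), v θ = v₁ θ ∨ v θ = v₂ θ) :
    IsAlmostPeriodic fun t => F t v := by
  have key : ∀ s t, ‖F s v - F t v‖ ≤ ‖F s v₁ - F t v₁‖ + ‖F s v₂ - F t v₂‖ := by
    intro s t
    set g₁ := F s v₁ - F t v₁ with hg₁
    set g₂ := F s v₂ - F t v₂ with hg₂
    have m₁ := (Lp.memLp g₁).norm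
    have m₂ := (Lp.memLp g₂).norm
    have e₁ : ‖m₁.toLp _‖ = ‖g₁‖ := by rw [Lp.norm_toLp, eLpNorm_norm, Lp.norm_def]
    have e₂ : ‖m₂.toLp _‖ = ‖g₂‖ := by rw [Lp.norm_toLp, eLpNorm_norm, Lp.norm_def]
    rw [← e₁, ← e₂]
    refine le_trans (Lp.norm_le_norm_of_ae_le ?_) (norm_add_le _ _)
    filter_upwards [hv, hF s v, hF t v, hF s v₁, hF t v₁, hF s v₂, hF t v₂,
      Lp.coeFn_sub (F s v) (F t v), Lp.coeFn_sub (F s v₁) (F t v₁),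
      Lp.coeFn_sub (F s v₂) (F t v₂), Lp.coeFn_add (m₁.toLp _) (m₂.toLp _), m₁.coeFn_toLp,
      m₂.coeFn_toLp] with θ hθ a1 a2 a3 a4 a5 a6 b b1 b2 c c1 c2
    rw [c, Pi.add_apply, c1, c2, Real.norm_of_nonneg (by positivity), hg₁, hg₂, b, b1, b2]
    simp only [Pi.sub_apply, a1, a2, a3, a4, a5, a6]
    rcases hθ with hθ | hθ <;> rw [hθ]
    · exact le_add_of_nonneg_right (norm_nonneg _)
    · exact le_add_of_nonneg_left (norm_nonneg _)
  refine .of_forall fun ε hε => ⟨_, _, _, h₁.prodMk h₂, ε / 2, half_pos hε, fun s t h => ?_⟩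
  rw [Prod.mk_sub_mk, Prod.norm_mk, max_le_iff] at h
  linarith [key s t]

variable [Fact (1 ≤ p)]

theorem nemytskii_shift_ae_eq {F : ℝ → LpUnit p X → LpUnit q Y}
    (hF : ∀ t v, F t v =ᵐ[volume.restrict (Ioo (0 : ℝ) 1)] fun θ => f (t + θ) (v θ))
    (u : BS p X) (t : ℝ) :
    F t (BS.transform u t) =ᵐ[volume.restrict (Ioo (0 : ℝ) 1)]
      fun θ => nemytskii f (u : ℝ →ₘ[volume] X) (t + θ) := by
  filter_upwards [hF t (BS.transform u t), BS.coeFn_transform u t] with θ h1 h2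
  rw [h1, h2, nemytskii]

/-- The identity `(N_f u)^b(t) = F t (u^b(t))`, in which local integrability is part of the
conclusion. -/
theorem exists_bochnerTransform_nemytskii {F : ℝ → LpUnit p X → LpUnit q Y}
    (hF : ∀ t v, F t v =ᵐ[volume.restrict (Ioo (0 : ℝ) 1)] fun θ => f (t + θ) (v θ))
    (u : BS p X) :
    ∃ h : MemLpLoc q (nemytskii f (u : ℝ →ₘ[volume] X)),
      ∀ t, bochnerTransform _ h t = F t (BS.transform u t) := by
  have hloc : MemLpLoc q (nemytskii f (u : ℝ →ₘ[volume] X)) := by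
    refine .of_unit_intervals fun t => ?_
    have h1 := (Lp.memLp (F t (BS.transform u t))).ae_eq (nemytskii_shift_ae_eq hF u t)
    have h2 := (measurePreserving_sub_right (volume : Measure ℝ) t).restrict_preimage
      (measurableSet_Ioo (a := (0 : ℝ)) (b := 1))
    have h3 : (fun s => s - t) ⁻¹' Ioo (0 : ℝ) 1 = Ioo t (t + 1) := by
      simp [add_comm]
    rw [h3] at h2
    simpa [Function.comp_def] using h1.comp_measurePreserving h2
  refine ⟨hloc, fun t => Lp.ext ?_⟩
  exact (hloc.shift t).coeFn_toLp.trans (nemytskii_shift_ae_eq hF u t).symm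

variable [Fact (1 ≤ q)]

/-- Let `N` be an operator on 1-periodic functions. For `t : ℝ` this is the operator induced by `N`
on the functions on the interval `(t, t + 1)`, which is identified with `(0, 1)` by translation. If
`N` is the Nemytskii operator of `f`, it sends `v` to `θ ↦ f(t + θ, v(θ))`. -/
def localOperator (N : LpPeriodic p X → BS q Y) (t : ℝ) (v : LpUnit p X) : LpUnit q Y :=
  BS.transform (N (periodicExtension t v)) t

theorem coeFn_localOperator {N : LpPeriodic p X → BS q Y}
    (hfN : ∀ u : LpPeriodic p X, (N u : ℝ →ₘ[volume] Y) =ᵐ[volume]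
      nemytskii f ((u : BS p X) : ℝ →ₘ[volume] X)) (t : ℝ) (v : LpUnit p X) :
    localOperator N t v =ᵐ[volume.restrict (Ioo (0 : ℝ) 1)] fun θ => f (t + θ) (v θ) := by
  have h1 := shift_ae_eq (hfN (periodicExtension t v)) t
  have h2 := shift_ae_eq (coeFn_periodicExtension t v) t
  filter_upwards [BS.coeFn_transform (N (periodicExtension t v)) t, h1, h2,
    ae_restrict_mem measurableSet_Ioo] with θ e1 e2 e3 hθ
  rw [add_sub_cancel_left, Int.fract_eq_self.2 ⟨hθ.1.le, hθ.2⟩] at e3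
  rw [localOperator, e1, e2, nemytskii, e3]

/-- The local operators are equicontinuous at the points of a compact set, uniformly in `t`. Since
periodic extension depends on `t` only modulo 1, the periodic extensions of the members of a compact
set form a compact set, at which a continuous operator is uniformly continuous. -/
theorem exists_forall_norm_localOperator_sub_le (hp : p ≠ ⊤) {N : LpPeriodic p X → BS q Y}
    (hN : Continuous N) {K : Set (LpUnit p X)} (hK : IsCompact K) {ε : ℝ} (hε : 0 < ε) :
    ∃ δ > 0, ∀ v ∈ K, ∀ w, ‖v - w‖ ≤ δ →
      ∀ t, ‖localOperator N t v - localOperator N t w‖ ≤ ε := by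
  have hK' := ((isCompact_Icc (a := (0 : ℝ)) (b := 1)).prod hK).image
    (continuous_periodicExtension hp)
  obtain ⟨δ, hδ, H⟩ := Metric.mem_uniformity_dist.1
    (hK'.uniformContinuousAt_of_continuousAt N (fun _ _ => hN.continuousAt)
      (Metric.dist_mem_uniformity hε))
  refine ⟨δ / 2, half_pos hδ, fun v hv w hvw t => ?_⟩
  have hmem : periodicExtension t v ∈
      (fun a : ℝ × LpUnit p X => periodicExtension a.1 a.2) '' (Icc 0 1 ×ˢ K) :=
    ⟨(Int.fract t, v), ⟨⟨Int.fract_nonneg t, (Int.fract_lt_one t).le⟩, hv⟩,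
      periodicExtension_fract t v⟩
  have hdist : dist (periodicExtension t v) (periodicExtension t w) < δ := by
    rw [(isometry_periodicExtension t).dist_eq, dist_eq_norm]
    exact hvw.trans_lt (half_lt_self hδ)
  have h : dist (N (periodicExtension t v)) (N (periodicExtension t w)) < ε := H hdist hmem
  rw [dist_eq_norm] at h
  rw [localOperator, localOperator, ← BS.transform_sub]
  exact (BS.norm_transform_le _ t).trans h.le

/-- Almost periodicity of `F t v` in `t` passes from constant functions `v` to simple functions, and
from these, by equicontinuity, to all of `L^p`. -/
theorem isAlmostPeriodic_of_const (hp : p ≠ ⊤) {F : ℝ → LpUnit p X → LpUnit q Y}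
    (hF : ∀ t v, F t v =ᵐ[volume.restrict (Ioo (0 : ℝ) 1)] fun θ => f (t + θ) (v θ))
    (hconst : ∀ x, IsAlmostPeriodic fun t => F t (Lp.const p _ x))
    (H : ∀ v, ∀ ε : ℝ, 0 < ε → ∃ δ > 0, ∀ w, ‖v - w‖ ≤ δ → ∀ t, ‖F t v - F t w‖ ≤ ε)
    (v : LpUnit p X) : IsAlmostPeriodic fun t => F t v := by
  refine Lp.induction hp (fun v => IsAlmostPeriodic fun t => F t v) ?_ ?_ ?_ v
  · intro x A hA hμA
    refine isAlmostPeriodic_of_ae_eq_or hF (hconst x) (hconst 0) ?_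
    rw [Lp.simpleFunc.coe_indicatorConst]
    filter_upwards [indicatorConstLp_coeFn (p := p) (hs := hA) (hμs := hμA.ne) (c := x),
      Lp.coeFn_const p (volume.restrict (Ioo (0 : ℝ) 1)) x,
      Lp.coeFn_const p (volume.restrict (Ioo (0 : ℝ) 1)) (0 : X)] with θ h1 h2 h3
    rw [h1, h2, h3]
    by_cases hθ : θ ∈ A <;> simp [hθ]
  · intro g h hg hh hd h1 h2
    refine isAlmostPeriodic_of_ae_eq_or hF h1 h2 ?_
    filter_upwards [Lp.coeFn_add (hg.toLp g) (hh.toLp h), hg.coeFn_toLp, hh.coeFn_toLp]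
      with θ e1 e2 e3
    rw [e1, Pi.add_apply, e2, e3]
    by_cases hθ : θ ∈ Function.support g
    · exact .inl (by rw [Function.notMem_support.1 (disjoint_left.1 hd hθ), add_zero])
    · exact .inr (by rw [Function.notMem_support.1 hθ, zero_add])
  · refine isClosed_of_closure_subset fun v hv => IsAlmostPeriodic.of_forall fun ε hε => ?_
    obtain ⟨δ, hδ, h⟩ := H v (ε / 3) (by positivity)
    obtain ⟨w, hw, hvw⟩ := Metric.mem_closure_iff.1 hv δ hδ
    rw [dist_eq_norm] at hvw
    refine ⟨_, _, _, hw, ε / 3, by positivity, fun s t hst => ?_⟩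
    have h1 := h w hvw.le s
    have h2 := h w hvw.le t
    rw [norm_sub_rev] at h2
    calc ‖F s v - F t v‖
        = ‖(F s v - F s w) + (F s w - F t w) + (F t w - F t v)‖ := by congr 1; abel
      _ ≤ ε / 3 + ε / 3 + ε / 3 := norm_add₃_le.trans (by gcongr)
      _ = ε := by ring

theorem NemytskiiContinuous.mono {A A' : Set (BS p X)} {B B' : Set (BS q Y)}
    (h : NemytskiiContinuous f A B) (hA : A' ⊆ A) (hB : B ⊆ B') : NemytskiiContinuous f A' B' :=
  let ⟨N, hN, hfN⟩ := h
  ⟨fun u => inclusion hB (N (inclusion hA u)),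
    (continuous_inclusion hB).comp (hN.comp (continuous_inclusion hA)),
    fun u => hfN (inclusion hA u)⟩

theorem NemytskiiContinuous.memSap_const
    (h : NemytskiiContinuous f (LpPeriodic p X) (Sap q Y)) (x : X) : MemSap q fun t => f t x := by
  obtain ⟨N, -, hfN⟩ := h
  have hx := (MemPeriodic.const (p := p) x).memBS
  have hmem : hx.toBS ∈ LpPeriodic p X := by
    have h1 := hx.coeFn_toBS
    have h2 := (measurePreserving_add_right volume (1 : ℝ)).quasiMeasurePreserving.ae h1
    refine ⟨hx.toBS.2.1, ?_⟩
    filter_upwards [h1, h2] with t h1 h2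
    rw [h1, h2]
  refine MemSap.congr (N ⟨_, hmem⟩).2 ((hfN ⟨_, hmem⟩).trans ?_)
  filter_upwards [hx.coeFn_toBS] with t ht
  rw [nemytskii, ht]

/-- A Nemytskii operator which acts continuously on periodic functions, and whose sections
`f(·, x)` are almost periodic, acts continuously on almost periodic functions. -/
theorem nemytskiiContinuous_sap [CompleteSpace X] (hp : p ≠ ⊤) (hf : ∀ x, MemSap q fun t => f t x)
    (hH : NemytskiiContinuous f (LpPeriodic p X) (univ : Set (BS q Y))) :
    NemytskiiContinuous f (Sap p X) (Sap q Y) := by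
  obtain ⟨N₀, hN₀, hfN⟩ := hH
  let N : LpPeriodic p X → BS q Y := fun u => N₀ u
  have hN : Continuous N := continuous_subtype_val.comp hN₀
  set F := localOperator N with hFdef
  have hF := coeFn_localOperator (N := N) hfN
  have hconst : ∀ x, IsAlmostPeriodic fun t => F t (Lp.const p _ x) := by
    intro x
    obtain ⟨hl, hap⟩ := hf x
    convert hap using 2 with t
    refine Lp.ext ((hF t _).trans (.trans ?_ (hl.shift t).coeFn_toLp.symm))
    filter_upwards [Lp.coeFn_const p (volume.restrict (Ioo (0 : ℝ) 1)) x] with θ hθ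
    rw [hθ]
    rfl
  have hFap : ∀ v, IsAlmostPeriodic fun t => F t v := by
    refine isAlmostPeriodic_of_const hp hF hconst fun v ε hε => ?_
    obtain ⟨δ, hδ, h⟩ := exists_forall_norm_localOperator_sub_le hp hN
      (isCompact_singleton (x := v)) hε
    exact ⟨δ, hδ, h v rfl⟩
  have hcomp : ∀ u : Sap p X, IsAlmostPeriodic (BS.transform (u : BS p X)) := fun u => u.2.2
  choose hloc htr using fun u : Sap p X => exists_bochnerTransform_nemytskii hF (u : BS p X)
  have hap : ∀ u : Sap p X, MemSap q (nemytskii f ((u : BS p X) : ℝ →ₘ[volume] X)) := by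
    refine fun u => ⟨hloc u, ?_⟩
    rw [funext (htr u)]
    exact (hcomp u).comp_of_equicontinuous hFap fun ε hε =>
      exists_forall_norm_localOperator_sub_le hp hN (hcomp u).isCompact_closure_range hε
  refine ⟨fun u => ⟨(hap u).memBS.toBS, (hap u).congr (hap u).memBS.coeFn_toBS.symm⟩, ?_,
    fun u => (hap u).memBS.coeFn_toBS⟩
  refine Metric.continuous_iff.2 fun u ε hε => ?_
  obtain ⟨δ, hδ, h⟩ := exists_forall_norm_localOperator_sub_le hp hN
    (hcomp u).isCompact_closure_range (half_pos hε)
  refine ⟨δ, hδ, fun w hw => lt_of_le_of_lt ?_ (half_lt_self hε)⟩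
  rw [dist_comm, Subtype.dist_eq, dist_eq_norm] at hw ⊢
  refine ciSup_le fun t => ?_
  rw [BS.transform_sub, MemBS.transform_toBS, MemBS.transform_toBS, htr, htr]
  refine h _ (subset_closure (mem_range_self t)) _ ?_ t
  rw [← BS.transform_sub]
  exact (BS.norm_transform_le _ t).trans hw.le

end Nemytskii

end Stepanov

end

theorem mainTheorem1 {X Y : Type*}
    [NormedAddCommGroup X] [NormedSpace ℝ X] [CompleteSpace X]
    [NormedAddCommGroup Y] [NormedSpace ℝ Y] [CompleteSpace Y]
    (p q : ENNReal) [Fact (1 ≤ p)] [Fact (1 ≤ q)] (hp : p ≠ ⊤) (hq : q ≠ ⊤)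
    (f : ℝ → X → Y) :
    List.TFAE [
      Stepanov.NemytskiiContinuous f (Stepanov.Sap p X) (Stepanov.Sap q Y),
      Stepanov.NemytskiiContinuous f (Stepanov.LpPeriodic p X) (Stepanov.Sap q Y),
      (∀ x : X, Stepanov.MemSap q (fun t => f t x)) ∧
        Stepanov.NemytskiiContinuous f (Stepanov.LpPeriodic p X)
          (Set.univ : Set (Stepanov.BS q Y))] := by
  tfae_have 1 → 2 := fun h =>
    h.mono (fun _ hu => Stepanov.MemPeriodic.memSap hp hu) Subset.rfl
  tfae_have 2 → 3 := fun h => ⟨h.memSap_const, h.mono Subset.rfl (subset_univ _)⟩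
  tfae_have 3 → 1 := fun h => Stepanov.nemytskiiContinuous_sap hp h.1 h.2
  tfae_finish
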